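/- Let $n\ge 1$ agents $1,\dots,n$ interact over a sequence of directed graphs $\mathcal G_k=(\{1,\dots,n\},E_k)$, $k\ge 0$, where $(j,i)\in E_k$ means that agent $j$ can send to agent $i$ at time $k$. Assume that the sequence is $B$-strongly connected: $B\ge 1$ is an integer such that for every $k\ge 0$ the graph with edge set $\bigcup_{t=kB}^{(k+1)B-1}E_t$ is strongly connected. Let $\theta^i\in\mathbb R$, $\sigma^i>0$ and $\tau^i=1/(\sigma^i)^2$. For $k\ge1$ let $S_k^i$ be real random variables on a probability space with $S_k^i\sim\mathcal N(\theta^i,(\sigma^i)^2)$, such that for each $i$ the sequence $(S_k^i)_{k\ge1}$ is independent (nothing is assumed about dependence between different agents). Let the likelihood models be $\ell^i(\cdot\,|\,\theta)=\mathcal N(\theta,(\sigma^i)^2)$, $\theta\in\mathbb R$. Let $d_k^j$ be the number of agents $i\ne j$ with $(j,i)\in E_k$, and set $[A_k]_{ij}=1/(d_k^j+1)$ if $i=j$ or $(j,i)\in E_k$, and $[A_k]_{ij}=0$ otherwise. Starting from $\tau_0^i=\tau^i$ and arbitrary initial guesses $\theta_0^i\in\mathbb R$, define for $k\ge 0$ $$\tau_{k+1}^i=\sum_{j=1}^n[A_k]_{ij}\tau_k^j+\tau^i,\qquad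 \theta_{k+1}^i=\frac{\sum_{j=1}^n[A_k]_{ij}\tau_k^j\theta_k^j+S_{k+1}^i\tau^i}{\tau_{k+1}^i}.$$ Let $$\theta^*=\frac{\sum_{i=1}^n\tau^i\theta^i}{\sum_{j=1}^n\tau^j}.$$ Then $\theta^*$ is the unique minimizer over $\theta\in\mathbb R$ of $\sum_{i=1}^n D_{KL}\big(\mathcal N(\theta^i,(\sigma^i)^2)\,\big\|\,\ell^i(\cdot\,|\,\theta)\big)$, and for every agent $i$, $\lim_{k\to\infty}\theta_k^i=\theta^*$ almost surely. -/

import Mathlib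

open MeasureTheory ProbabilityTheory Filter Topology
open scoped NNReal ENNReal

namespace DistLearning

/-- A directed graph is strongly connected if every node can be reached from every node
along directed edges. -/
def StronglyConnected {n : ℕ} (H : Digraph (Fin n)) : Prop :=
  ∀ i j, Relation.ReflTransGen H.Adj i j

/-- The union of the edge sets `E_{kB}, …, E_{(k+1)B-1}`. -/
def windowGraph {n : ℕ} (G : ℕ → Digraph (Fin n)) (B k : ℕ) : Digraph (Fin n) where
  Adj i j := ∃ t, k * B ≤ t ∧ t < (k + 1) * B ∧ (G t).Adj i j

/-- `B`-strong connectivity of a sequence of directed graphs. -/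
def BStronglyConnected {n : ℕ} (G : ℕ → Digraph (Fin n)) (B : ℕ) : Prop :=
  1 ≤ B ∧ ∀ k, StronglyConnected (windowGraph G B k)

open Classical in
/-- Out-degree of `j`: the number of agents other than `j` to which `j` can send.
`H.Adj j i` means that `j` can communicate with `i`. -/
noncomputable def outDegree {n : ℕ} (H : Digraph (Fin n)) (j : Fin n) : ℕ :=
  (Finset.univ.filter fun i => i ≠ j ∧ H.Adj j i).card

open Classical in
/-- The weight matrix: agent `j` splits its mass equally among itself and its out-neighbours.
Row `i`, column `j`; every agent has access to its own value, so `i = j` counts as an edge. -/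
noncomputable def weight {n : ℕ} (H : Digraph (Fin n)) : Matrix (Fin n) (Fin n) ℝ :=
  fun i j => if i = j ∨ H.Adj j i then 1 / ((outDegree H j : ℝ) + 1) else 0

/-- The precision `τ^i = 1 / (σ^i)^2` of the observations of agent `i`. -/
noncomputable def precision {n : ℕ} (σ : Fin n → ℝ≥0) (i : Fin n) : ℝ :=
  1 / (σ i : ℝ) ^ 2

/-- The precisions `τ_k^i` generated by the algorithm, started at `τ_0^i = τ^i`. -/
noncomputable def precisionSeq {n : ℕ} (G : ℕ → Digraph (Fin n)) (σ : Fin n → ℝ≥0) :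
    ℕ → Fin n → ℝ
  | 0 => precision σ
  | k + 1 => fun i => ∑ j, weight (G k) i j * precisionSeq G σ k j + precision σ i

/-- The estimates `θ_k^i` generated by the algorithm from the initial guesses `θ₀` and the
observed values `s k i` (`k ≥ 1`; the value `s 0 i` is never used). -/
noncomputable def estimateSeq {n : ℕ} (G : ℕ → Digraph (Fin n)) (σ : Fin n → ℝ≥0)
    (θ₀ : Fin n → ℝ) (s : ℕ → Fin n → ℝ) : ℕ → Fin n → ℝ
  | 0 => θ₀
  | k + 1 => fun i =>
      (∑ j, weight (G k) i j * precisionSeq G σ k j * estimateSeq G σ θ₀ s k j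
        + s (k + 1) i * precision σ i) / precisionSeq G σ (k + 1) i

/-- The likelihood model `ℓ^i(· | θ) = N(θ, (σ^i)^2)`. -/
noncomputable def likelihood {n : ℕ} (σ : Fin n → ℝ≥0) (i : Fin n) (θ : ℝ) : Measure ℝ :=
  gaussianReal θ (σ i ^ 2)

/-- The network objective `F(θ) = ∑ i, D_KL(f^i ‖ ℓ^i(· | θ))` for given observation laws
`f^i` and likelihood models `ℓ^i`. -/
noncomputable def objective {n : ℕ} (f : Fin n → Measure ℝ) (ℓ : Fin n → ℝ → Measure ℝ)
    (θ : ℝ) : ℝ≥0∞ :=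
  ∑ i, InformationTheory.klDiv (f i) (ℓ i θ)

/-- `θ^* = (∑ i, τ^i θ^i) / (∑ j, τ^j)`. -/
noncomputable def thetaStar {n : ℕ} (θ : Fin n → ℝ) (σ : Fin n → ℝ≥0) : ℝ :=
  (∑ i, precision σ i * θ i) / ∑ j, precision σ j

end DistLearning

/-! Between Gaussians of equal variance the divergence is quadratic in the means, so the objective
is a weighted least-squares sum, minimized only at the weighted mean. For the limit, `τ_k` and `τ_k
θ_k` (componentwise) both obey `x (k+1) = A_k x k + u k` with `A_k` column stochastic, so total mass
changes only through the inputs. Products of `n * (2 * B)` consecutive matrices have all entries at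
least some `δ > 0` (`pow_le_transition`), hence contract sum-zero vectors in ℓ¹. Thus `x k` is total
mass times the push-sum weights `w_k`, up to `o(k)` (`tendsto_deviation_div`). Since eventually `w_k
≥ δ`, `x_k^i / (k w_k^i)` tends to the sum of the input averages (`tendsto_div_pushWeight`). In the
quotient of the two sequences `k w_k^i` cancels; the strong law supplies the averages. -/

namespace DistLearning

/-! ### Gaussian divergences and the minimizer. -/

section Divergence

lemma gaussianReal_tilted_mul (a b : ℝ) {v : ℝ≥0} (hv : v ≠ 0) :
    (gaussianReal a v).tilted (fun x => (b - a) / v * x) = gaussianReal b v := by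
  have hv' : (v : ℝ) ≠ 0 := by exact_mod_cast hv
  have hm : ∫ x, Real.exp ((b - a) / v * x) ∂gaussianReal a v
      = Real.exp (a * ((b - a) / v) + v * ((b - a) / v) ^ 2 / 2) :=
    congrFun (mgf_id_gaussianReal (μ := a) (v := v)) ((b - a) / v)
  rw [Measure.tilted, hm, gaussianReal_of_var_ne_zero a hv, gaussianReal_of_var_ne_zero b hv,
    ← withDensity_mul _ (measurable_gaussianPDF a v) (by fun_prop)]
  congr 1
  ext x
  rw [Pi.mul_apply, gaussianPDF, gaussianPDF, ← ENNReal.ofReal_mul (gaussianPDFReal_nonneg a v x),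
    gaussianPDFReal, gaussianPDFReal, mul_assoc, ← Real.exp_sub, ← Real.exp_add]
  congr 3
  field_simp
  ring

/-- Since `N(b, v)` is a linear exponential tilt of `N(a, v)`, the log-likelihood ratio is an affine
function whose constant is the log of the moment generating function. -/
lemma klDiv_gaussianReal (a b : ℝ) {v : ℝ≥0} (hv : v ≠ 0) :
    InformationTheory.klDiv (gaussianReal a v) (gaussianReal b v)
      = ENNReal.ofReal ((b - a) ^ 2 / (2 * v)) := by
  have hv' : (v : ℝ) ≠ 0 := by exact_mod_cast hv
  have hm : ∫ x, Real.exp ((b - a) / v * x) ∂gaussianReal a v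
      = Real.exp (a * ((b - a) / v) + v * ((b - a) / v) ^ 2 / 2) :=
    congrFun (mgf_id_gaussianReal (μ := a) (v := v)) ((b - a) / v)
  have hexp : Integrable (fun x => Real.exp ((b - a) / v * x)) (gaussianReal a v) :=
    integrable_exp_mul_gaussianReal _
  have hid : Integrable (fun x : ℝ => x) (gaussianReal a v) :=
    (memLp_id_gaussianReal (μ := a) (v := v) 1).integrable (by simp)
  have hlin := hid.const_mul ((b - a) / v)
  have hself : llr (gaussianReal a v) (gaussianReal a v) =ᵐ[gaussianReal a v] 0 := llr_self _
  have hselfint : Integrable (llr (gaussianReal a v) (gaussianReal a v)) (gaussianReal a v) :=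
    (integrable_congr hself).2 (integrable_zero _ _ _)
  have hac : gaussianReal a v ≪ gaussianReal b v :=
    (gaussianReal_absolutelyContinuous a hv).trans (gaussianReal_absolutelyContinuous' b hv)
  have hint : Integrable (llr (gaussianReal a v) (gaussianReal b v)) (gaussianReal a v) := by
    rw [← gaussianReal_tilted_mul a b hv]
    exact integrable_llr_tilted_right Measure.AbsolutelyContinuous.rfl hlin hselfint hexp
  have hval : ∫ x, llr (gaussianReal a v) (gaussianReal b v) x ∂gaussianReal a v
      = (b - a) ^ 2 / (2 * v) := by
    have h := integral_llr_tilted_right (Measure.AbsolutelyContinuous.refl _) hlin hexp hselfint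
    rw [gaussianReal_tilted_mul a b hv, integral_congr_ae hself, hm, Real.log_exp,
      integral_const_mul, integral_id_gaussianReal] at h
    rw [h]
    simp only [Pi.zero_apply, integral_zero]
    field_simp
    ring
  rw [InformationTheory.klDiv_of_ac_of_integrable hac hint, hval]
  simp

variable {n : ℕ}

lemma objective_gaussian (θ : Fin n → ℝ) (σ : Fin n → ℝ≥0) (hσ : ∀ i, 0 < σ i) (x : ℝ) :
    objective (fun i => gaussianReal (θ i) (σ i ^ 2)) (likelihood σ) x
      = ENNReal.ofReal (∑ i, precision σ i * (x - θ i) ^ 2 / 2) := by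
  rw [objective, ENNReal.ofReal_sum_of_nonneg
    (fun i _ => by unfold precision; positivity)]
  refine Finset.sum_congr rfl fun i _ => ?_
  rw [likelihood, klDiv_gaussianReal _ _ (pow_ne_zero 2 (hσ i).ne')]
  congr 1
  have : (σ i : ℝ) ≠ 0 := by exact_mod_cast (hσ i).ne'
  rw [precision]
  push_cast
  field_simp

lemma precision_pos {σ : Fin n → ℝ≥0} (hσ : ∀ i, 0 < σ i) (i : Fin n) : 0 < precision σ i := by
  have : (0 : ℝ) < σ i := by exact_mod_cast hσ i
  unfold precision
  positivity

lemma sum_precision_pos (hn : 0 < n) {σ : Fin n → ℝ≥0} (hσ : ∀ i, 0 < σ i) :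
    0 < ∑ i, precision σ i :=
  Finset.sum_pos (fun i _ => precision_pos hσ i) ⟨⟨0, hn⟩, Finset.mem_univ _⟩

lemma objective_thetaStar_lt (hn : 0 < n) (θ : Fin n → ℝ) (σ : Fin n → ℝ≥0) (hσ : ∀ i, 0 < σ i)
    {x : ℝ} (hx : x ≠ thetaStar θ σ) :
    objective (fun i => gaussianReal (θ i) (σ i ^ 2)) (likelihood σ) (thetaStar θ σ) <
      objective (fun i => gaussianReal (θ i) (σ i ^ 2)) (likelihood σ) x := by
  have hT := sum_precision_pos hn hσ
  have hstar : thetaStar θ σ * ∑ i, precision σ i = ∑ i, precision σ i * θ i := by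
    rw [thetaStar]; field_simp
  have hexpand : ∀ y, ∑ i, precision σ i * (y - θ i) ^ 2 / 2
      = y ^ 2 / 2 * (∑ i, precision σ i) - y * (∑ i, precision σ i * θ i)
        + ∑ i, precision σ i * θ i ^ 2 / 2 := fun y => by
    rw [Finset.mul_sum, Finset.mul_sum, ← Finset.sum_sub_distrib, ← Finset.sum_add_distrib]
    exact Finset.sum_congr rfl fun i _ => by ring
  have hlt : ∑ i, precision σ i * (thetaStar θ σ - θ i) ^ 2 / 2
      < ∑ i, precision σ i * (x - θ i) ^ 2 / 2 := by
    rw [hexpand, hexpand, ← hstar]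
    -- Completing the square, the gap is `(x - θ*)² / 2` times the total precision.
    nlinarith [mul_pos hT (sq_pos_of_ne_zero (sub_ne_zero.2 hx))]
  rw [objective_gaussian θ σ hσ, objective_gaussian θ σ hσ]
  exact (ENNReal.ofReal_lt_ofReal_iff_of_nonneg (Finset.sum_nonneg fun i _ => by
    have := (precision_pos hσ i).le; positivity)).2 hlt

end Divergence

/-! ### Column stochasticity and lower bounds of the weights. -/

section Weights

variable {n : ℕ}

lemma outDegree_add_one_le (H : Digraph (Fin n)) (j : Fin n) : outDegree H j + 1 ≤ n := by
  classical
  have hsub : (Finset.univ.filter fun i => i ≠ j ∧ H.Adj j i) ⊆ Finset.univ.erase j :=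
    fun i hi => Finset.mem_erase.2 ⟨(Finset.mem_filter.1 hi).2.1, Finset.mem_univ _⟩
  have h := Finset.card_le_card hsub
  rw [Finset.card_erase_of_mem (Finset.mem_univ _), Finset.card_univ, Fintype.card_fin] at h
  have hj := j.pos
  have : outDegree H j ≤ n - 1 := by
    unfold outDegree
    convert h
  omega

lemma inv_le_weight {H : Digraph (Fin n)} {i j : Fin n} (h : i = j ∨ H.Adj j i) :
    (n : ℝ)⁻¹ ≤ weight H i j := by
  have hle : ((outDegree H j : ℝ) + 1) ≤ n := by exact_mod_cast outDegree_add_one_le H j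
  rw [weight, if_pos h, one_div]
  exact inv_anti₀ (by positivity) hle

lemma weight_mem_colStochastic (H : Digraph (Fin n)) :
    weight H ∈ Matrix.colStochastic ℝ (Fin n) := by
  classical
  rw [Matrix.mem_colStochastic_iff_sum]
  refine ⟨fun i j => ?_, fun j => ?_⟩
  · unfold weight
    split_ifs <;> positivity
  · have hset : (Finset.univ.filter fun i => i = j ∨ H.Adj j i)
        = insert j (Finset.univ.filter fun i => i ≠ j ∧ H.Adj j i) := by
      ext i
      by_cases h : i = j <;> simp [h]
    have hcard : (Finset.univ.filter fun i => i = j ∨ H.Adj j i).card = outDegree H j + 1 := by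
      rw [hset, Finset.card_insert_of_notMem (by simp), outDegree]
    have hsum : ∑ i, weight H i j
        = ∑ i, if i = j ∨ H.Adj j i then 1 / ((outDegree H j : ℝ) + 1) else 0 :=
      Finset.sum_congr rfl fun i _ => by unfold weight; congr
    rw [hsum, ← Finset.sum_filter, Finset.sum_const, hcard, nsmul_eq_mul]
    push_cast
    field_simp

end Weights

/-! ### Spreading along the edges of successive windows. -/

section Connectivity

variable {n : ℕ}

/-- In a `B`-strongly connected sequence, every window of length `2B` contains an aligned one. -/
lemma BStronglyConnected.reachable {G : ℕ → Digraph (Fin n)} {B : ℕ}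
    (hG : BStronglyConnected G B) (s : ℕ) (a b : Fin n) :
    Relation.ReflTransGen (fun x y => ∃ t < 2 * B, (G (s + t)).Adj x y) a b := by
  obtain ⟨hB, h⟩ := hG
  -- The next aligned block starts in `(s, s + B]`, so it ends by `s + 2 * B`.
  refine Relation.ReflTransGen.mono ?_ _ _ (h (s / B + 1) a b)
  rintro x y ⟨t, ht₁, ht₂, hadj⟩
  have h₁ := Nat.div_add_mod s B
  have h₂ := Nat.mod_lt s hB
  have h₃ : (s / B + 1) * B = B * (s / B) + B := by ring
  have h₄ : (s / B + 1 + 1) * B = B * (s / B) + 2 * B := by ring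
  refine ⟨t - s, by omega, ?_⟩
  rwa [Nat.add_sub_cancel' (by omega)]

lemma exists_edge_leaving {V : Type*} {r : V → V → Prop} {a b : V}
    (h : Relation.ReflTransGen r a b) {R : Finset V} (ha : a ∈ R) (hb : b ∉ R) :
    ∃ x y, r x y ∧ x ∈ R ∧ y ∉ R := by
  by_contra! hcon
  refine hb ?_
  clear hb
  induction h with
  | refl => exact ha
  | tail _ hbc ih => exact hcon _ _ hbc ih

/-- A set that never shrinks and absorbs all current out-neighbours becomes everything after `n`
windows, if the edges of each window connect the graph. -/
lemma eq_univ_of_absorbing {H : ℕ → Digraph (Fin n)} {B : ℕ}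
    (hH : ∀ s a b, Relation.ReflTransGen (fun x y => ∃ t < B, (H (s + t)).Adj x y) a b)
    {R : ℕ → Finset (Fin n)} (hmono : Monotone R) (hne : (R 0).Nonempty)
    (habs : ∀ t a b, a ∈ R t → (H t).Adj a b → b ∈ R (t + 1)) :
    R (n * B) = Finset.univ := by
  -- Each window adds a vertex until none is missing; at `m = n` the second alternative exceeds the
  -- number of vertices.
  have hgrow : ∀ m, R (m * B) = Finset.univ ∨ m + 1 ≤ (R (m * B)).card := by
    intro m
    induction m with
    | zero => exact Or.inr (by simpa using hne.card_pos)
    | succ m ih =>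
      have hle : R (m * B) ⊆ R ((m + 1) * B) := hmono (Nat.mul_le_mul_right _ (Nat.le_succ m))
      rcases ih with ih | ih
      · exact Or.inl (Finset.univ_subset_iff.1 (ih ▸ hle))
      by_cases huniv : R (m * B) = Finset.univ
      · exact Or.inl (Finset.univ_subset_iff.1 (huniv ▸ hle))
      right
      obtain ⟨a, ha⟩ := Finset.card_pos.1 (lt_of_lt_of_le (Nat.succ_pos m) ih)
      obtain ⟨b, hb⟩ : ∃ b, b ∉ R (m * B) := by
        by_contra! hall
        exact huniv (Finset.eq_univ_iff_forall.2 hall)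
      obtain ⟨x, y, ⟨t, ht, hadj⟩, hx, hy⟩ := exists_edge_leaving (hH (m * B) a b) ha hb
      have hy' : y ∈ R ((m + 1) * B) :=
        hmono (by rw [add_mul]; omega) (habs _ _ _ (hmono (Nat.le_add_right _ t) hx) hadj)
      have hlt : (R (m * B)).card < (R ((m + 1) * B)).card :=
        Finset.card_lt_card ⟨hle, fun hcon => hy (hcon hy')⟩
      omega
  rcases hgrow n with h | h
  · exact h
  · have := Finset.card_le_univ (R (n * B))
    rw [Fintype.card_fin] at this
    omega

end Connectivity

/-! ### Uniform positivity of long matrix products. -/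

section Transition

variable {n : ℕ}

/-- The product `A (k + L - 1) * ⋯ * A k` of `L` consecutive matrices of a sequence. -/
def transition (A : ℕ → Matrix (Fin n) (Fin n) ℝ) (k : ℕ) : ℕ → Matrix (Fin n) (Fin n) ℝ
  | 0 => 1
  | L + 1 => A (k + L) * transition A k L

lemma transition_mem_colStochastic {A : ℕ → Matrix (Fin n) (Fin n) ℝ}
    (hA : ∀ k, A k ∈ Matrix.colStochastic ℝ (Fin n)) (k L : ℕ) :
    transition A k L ∈ Matrix.colStochastic ℝ (Fin n) := by
  induction L with
  | zero => exact one_mem _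
  | succ L ih => exact mul_mem (hA _) ih

/-- Each edge or self-loop costs at most a factor `1 / n`, so the rows whose entry in column `j` is
at least `n⁻¹ ^ L` form an absorbing family of sets in `L`. -/
lemma pow_le_transition {G : ℕ → Digraph (Fin n)} {B : ℕ} (hG : BStronglyConnected G B)
    (k : ℕ) (i j : Fin n) :
    (n : ℝ)⁻¹ ^ (n * (2 * B)) ≤ transition (fun t => weight (G t)) k (n * (2 * B)) i j := by
  classical
  set A : ℕ → Matrix (Fin n) (Fin n) ℝ := fun t => weight (G t) with hAdef
  have hA : ∀ t, A t ∈ Matrix.colStochastic ℝ (Fin n) := fun t => weight_mem_colStochastic _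
  have hstep : ∀ L a b, (b = a ∨ (G (k + L)).Adj a b) →
      (n : ℝ)⁻¹ ^ L ≤ transition A k L a j → (n : ℝ)⁻¹ ^ (L + 1) ≤ transition A k (L + 1) b j := by
    intro L a b hab ha
    calc (n : ℝ)⁻¹ ^ (L + 1) = (n : ℝ)⁻¹ * (n : ℝ)⁻¹ ^ L := pow_succ' _ _
      _ ≤ A (k + L) b a * transition A k L a j :=
        mul_le_mul (inv_le_weight hab) ha (by positivity)
          (Matrix.nonneg_of_mem_colStochastic (hA _))
      _ ≤ ∑ c, A (k + L) b c * transition A k L c j :=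
        Finset.single_le_sum (f := fun c => A (k + L) b c * transition A k L c j)
          (fun c _ => mul_nonneg (Matrix.nonneg_of_mem_colStochastic (hA _))
            (Matrix.nonneg_of_mem_colStochastic (transition_mem_colStochastic hA k L)))
          (Finset.mem_univ a)
      _ = transition A k (L + 1) b j := rfl
  have h := eq_univ_of_absorbing (H := fun t => G (k + t)) (B := 2 * B)
    (R := fun L => Finset.univ.filter fun a => (n : ℝ)⁻¹ ^ L ≤ transition A k L a j)
    (fun s a b => by simpa only [add_assoc] using hG.reachable (k + s) a b)
    (monotone_nat_of_le_succ fun L a ha => by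
      simp only [Finset.mem_filter, Finset.mem_univ, true_and] at ha ⊢
      exact hstep L a a (Or.inl rfl) ha)
    ⟨j, by simp [transition]⟩
    (fun L a b ha hab => by
      simp only [Finset.mem_filter, Finset.mem_univ, true_and] at ha ⊢
      exact hstep L a b (Or.inr hab) ha)
  exact (Finset.mem_filter.1 (Finset.eq_univ_iff_forall.1 h i)).2

end Transition

/-! ### ℓ¹ estimates for nonnegative matrices. -/

section Contraction

variable {n : ℕ} {M : Matrix (Fin n) (Fin n) ℝ}

lemma sum_abs_mulVec_le {c : ℝ} (hM : ∀ i j, 0 ≤ M i j) (hc : ∀ j, ∑ i, M i j = c)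
    (x : Fin n → ℝ) : ∑ i, |(M.mulVec x) i| ≤ c * ∑ i, |x i| :=
  calc ∑ i, |(M.mulVec x) i| ≤ ∑ i, ∑ j, M i j * |x j| :=
        Finset.sum_le_sum fun i _ =>
          (Finset.abs_sum_le_sum_abs (fun j => M i j * x j) Finset.univ).trans_eq
            (Finset.sum_congr rfl fun j _ => by rw [abs_mul, abs_of_nonneg (hM i j)])
    _ = ∑ j, (∑ i, M i j) * |x j| := by
        rw [Finset.sum_comm]
        exact Finset.sum_congr rfl fun j _ => (Finset.sum_mul _ _ _).symm
    _ = c * ∑ i, |x i| := by simp_rw [hc, Finset.mul_sum]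

lemma sum_abs_mulVec_le_of_mem_colStochastic (hM : M ∈ Matrix.colStochastic ℝ (Fin n))
    (x : Fin n → ℝ) : ∑ i, |(M.mulVec x) i| ≤ ∑ i, |x i| := by
  simpa using sum_abs_mulVec_le (fun i j => Matrix.nonneg_of_mem_colStochastic hM)
    (Matrix.sum_col_of_mem_colStochastic hM) x

/-- A column stochastic matrix with entries at least `δ` contracts vectors of sum zero. -/
lemma sum_abs_mulVec_le_of_sum_eq_zero (hM : M ∈ Matrix.colStochastic ℝ (Fin n)) {δ : ℝ}
    (hδ : ∀ i j, δ ≤ M i j) {x : Fin n → ℝ} (hx : ∑ i, x i = 0) :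
    ∑ i, |(M.mulVec x) i| ≤ (1 - n * δ) * ∑ i, |x i| := by
  -- Subtracting a constant matrix leaves the action on sum-zero vectors unchanged but lowers the
  -- column sums.
  have h := sum_abs_mulVec_le (M := M - Matrix.of fun _ _ => δ) (c := 1 - n * δ)
    (fun i j => sub_nonneg.2 (hδ i j))
    (fun j => by simp [Finset.sum_sub_distrib, Matrix.sum_col_of_mem_colStochastic hM]) x
  have hzero : (Matrix.of fun _ _ : Fin n => δ).mulVec x = 0 := by
    ext i
    simp [Matrix.mulVec, dotProduct, ← Finset.mul_sum, hx]
  rwa [Matrix.sub_mulVec, hzero, sub_zero] at h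

end Contraction

/-! ### Sublinear growth of real sequences. -/

section Sublinear

/-- The line `C + ε / 2 * k` is preserved as a majorant once `b k < ε / 2 * (1 - r) * k`; `C` sums
the earlier values, covering the base cases. -/
lemma tendsto_div_of_contraction {f b : ℕ → ℝ} {r : ℝ} {L : ℕ} (hf : ∀ k, 0 ≤ f k)
    (hr₀ : 0 ≤ r) (hr₁ : r < 1) (hL : 0 < L)
    (hb : Tendsto (fun k => b k / k) atTop (𝓝 0)) (h : ∀ k, f (k + L) ≤ r * f k + b k) :
    Tendsto (fun k => f k / k) atTop (𝓝 0) := by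
  refine tendsto_order.2 ⟨fun a ha => Eventually.of_forall fun k =>
    lt_of_lt_of_le ha (div_nonneg (hf k) k.cast_nonneg), fun ε hε => ?_⟩
  have hev : ∀ᶠ k : ℕ in atTop, b k / k < ε / 2 * (1 - r) :=
    (tendsto_order.1 hb).2 _ (by nlinarith)
  obtain ⟨M, hM⟩ := eventually_atTop.1 (hev.and (eventually_gt_atTop 0))
  set C := ∑ k ∈ Finset.range (M + L), f k with hC
  have hC₀ : 0 ≤ C := Finset.sum_nonneg fun k _ => hf k
  have hbound : ∀ k, f k ≤ C + ε / 2 * k := by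
    intro k
    induction k using Nat.strong_induction_on with
    | _ k ih =>
      by_cases hk : k < M + L
      · have h₁ : f k ≤ C :=
          Finset.single_le_sum (f := f) (fun k _ => hf k) (Finset.mem_range.2 hk)
        have : 0 ≤ ε / 2 * k := by positivity
        linarith
      · obtain ⟨j, rfl⟩ : ∃ j, k = j + L := ⟨k - L, by omega⟩
        have h₁ := mul_le_mul_of_nonneg_left (ih j (by omega)) hr₀
        obtain ⟨h₂, hj⟩ := hM j (by omega)
        rw [div_lt_iff₀ (by exact_mod_cast hj)] at h₂
        have h₃ : (0 : ℝ) ≤ L := L.cast_nonneg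
        push_cast
        nlinarith [h j, mul_nonneg hε.le h₃, mul_nonneg (sub_nonneg.2 hr₁.le) hC₀]
  filter_upwards [(tendsto_order.1 (tendsto_const_div_atTop_nhds_zero_nat C)).2 _ (half_pos hε),
    eventually_gt_atTop 0] with k hk hk₀
  have hk₀' : (0 : ℝ) < k := by exact_mod_cast hk₀
  have h₂ := hbound k
  rw [div_lt_iff₀ hk₀'] at hk ⊢
  linarith

lemma tendsto_shift_div {g : ℕ → ℝ} (hg : Tendsto (fun k => g k / k) atTop (𝓝 0)) (t : ℕ) :
    Tendsto (fun k => g (k + t) / k) atTop (𝓝 0) := by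
  have h₁ := hg.comp (tendsto_add_atTop_nat t)
  have h₂ : Tendsto (fun k : ℕ => 1 + (t : ℝ) / k) atTop (𝓝 (1 + 0)) :=
    (tendsto_const_div_atTop_nhds_zero_nat (t : ℝ)).const_add 1
  have h₃ := h₁.mul h₂
  rw [zero_mul] at h₃
  refine h₃.congr' ?_
  filter_upwards [eventually_gt_atTop 0] with k hk
  have hk' : (0 : ℝ) < k := by exact_mod_cast hk
  simp only [Function.comp_apply]
  push_cast
  field_simp

/-- `u k / k` is `(1 + 1 / k)` times the average at `k + 1`, minus the average at `k`. -/
lemma tendsto_div_of_tendsto_average {u : ℕ → ℝ} {c : ℝ}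
    (h : Tendsto (fun k : ℕ => (∑ t ∈ Finset.range k, u t) / k) atTop (𝓝 c)) :
    Tendsto (fun k => u k / k) atTop (𝓝 0) := by
  have h₁ := h.comp (tendsto_add_atTop_nat 1)
  have h₂ : Tendsto (fun k : ℕ => 1 + (1 : ℝ) / k) atTop (𝓝 (1 + 0)) :=
    (tendsto_const_div_atTop_nhds_zero_nat 1).const_add 1
  have h₃ := (h₁.mul h₂).sub h
  rw [show c * (1 + 0) - c = 0 by ring] at h₃
  refine h₃.congr' ?_
  filter_upwards [eventually_gt_atTop 0] with k hk
  have hk' : (0 : ℝ) < k := by exact_mod_cast hk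
  simp only [Function.comp_apply, Finset.sum_range_succ]
  push_cast
  field_simp
  ring

end Sublinear

/-! ### Push-sum dynamics with additive inputs. -/

section PushSum

variable {n : ℕ}

lemma sum_abs_sub_transition_le {A : ℕ → Matrix (Fin n) (Fin n) ℝ}
    (hA : ∀ k, A k ∈ Matrix.colStochastic ℝ (Fin n)) {e v : ℕ → Fin n → ℝ}
    (he : ∀ k, e (k + 1) = (A k).mulVec (e k) + v k) (k L : ℕ) :
    ∑ i, |e (k + L) i - ((transition A k L).mulVec (e k)) i|
      ≤ ∑ t ∈ Finset.range L, ∑ i, |v (k + t) i| := by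
  induction L with
  | zero => simp [transition]
  | succ L ih =>
    have hrec : e (k + (L + 1)) - (transition A k (L + 1)).mulVec (e k)
        = (A (k + L)).mulVec (e (k + L) - (transition A k L).mulVec (e k)) + v (k + L) := by
      rw [← add_assoc, he, transition, Matrix.mulVec_sub, Matrix.mulVec_mulVec]
      abel
    calc ∑ i, |e (k + (L + 1)) i - ((transition A k (L + 1)).mulVec (e k)) i|
        = ∑ i, |((A (k + L)).mulVec (e (k + L) - (transition A k L).mulVec (e k))) i
            + v (k + L) i| :=
          Finset.sum_congr rfl fun i _ => congrArg abs (congrFun hrec i)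
      _ ≤ ∑ i, |((A (k + L)).mulVec (e (k + L) - (transition A k L).mulVec (e k))) i|
            + ∑ i, |v (k + L) i| := by
          rw [← Finset.sum_add_distrib]
          exact Finset.sum_le_sum fun i _ => abs_add_le _ _
      _ ≤ ∑ t ∈ Finset.range (L + 1), ∑ i, |v (k + t) i| := by
          rw [Finset.sum_range_succ]
          have := sum_abs_mulVec_le_of_mem_colStochastic (hA (k + L))
            (e (k + L) - (transition A k L).mulVec (e k))
          simp only [Pi.sub_apply] at this
          linarith

/-- The push-sum weights: the image of the uniform distribution under the first `k` steps. -/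
noncomputable def pushWeight (A : ℕ → Matrix (Fin n) (Fin n) ℝ) (k : ℕ) : Fin n → ℝ :=
  (transition A 0 k).mulVec fun _ => (n : ℝ)⁻¹

lemma pushWeight_succ (A : ℕ → Matrix (Fin n) (Fin n) ℝ) (k : ℕ) :
    pushWeight A (k + 1) = (A k).mulVec (pushWeight A k) := by
  rw [pushWeight, pushWeight, transition, zero_add, Matrix.mulVec_mulVec]

lemma pushWeight_nonneg {A : ℕ → Matrix (Fin n) (Fin n) ℝ}
    (hA : ∀ k, A k ∈ Matrix.colStochastic ℝ (Fin n)) (k : ℕ) (i : Fin n) :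
    0 ≤ pushWeight A k i :=
  Matrix.nonneg_mulVec_of_mem_colStochastic (transition_mem_colStochastic hA 0 k)
    (fun _ => by positivity) i

lemma sum_pushWeight (hn : 0 < n) {A : ℕ → Matrix (Fin n) (Fin n) ℝ}
    (hA : ∀ k, A k ∈ Matrix.colStochastic ℝ (Fin n)) (k : ℕ) : ∑ i, pushWeight A k i = 1 := by
  have hn' : (n : ℝ) ≠ 0 := by exact_mod_cast hn.ne'
  rw [pushWeight, Matrix.sum_mulVec_of_mem_colStochastic (transition_mem_colStochastic hA 0 k)]
  simp [hn']

lemma pushWeight_add (A : ℕ → Matrix (Fin n) (Fin n) ℝ) (k L : ℕ) :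
    pushWeight A (k + L) = (transition A k L).mulVec (pushWeight A k) := by
  induction L with
  | zero => simp [transition]
  | succ L ih => rw [← add_assoc, pushWeight_succ, ih, transition, Matrix.mulVec_mulVec]

lemma le_pushWeight (hn : 0 < n) {A : ℕ → Matrix (Fin n) (Fin n) ℝ}
    (hA : ∀ k, A k ∈ Matrix.colStochastic ℝ (Fin n)) {δ : ℝ} {L : ℕ}
    (hδ : ∀ k i j, δ ≤ transition A k L i j) (k : ℕ) (i : Fin n) :
    δ ≤ pushWeight A (k + L) i := by
  rw [pushWeight_add]
  calc δ = ∑ j, δ * pushWeight A k j := by rw [← Finset.mul_sum, sum_pushWeight hn hA, mul_one]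
    _ ≤ ∑ j, transition A k L i j * pushWeight A k j :=
      Finset.sum_le_sum fun j _ => mul_le_mul_of_nonneg_right (hδ k i j) (pushWeight_nonneg hA k j)

/-- Iterating column stochastic matrices with additive input `u`, the state follows the push-sum
weights times the total mass, up to a sublinear error. -/
lemma tendsto_deviation_div (hn : 0 < n) {A : ℕ → Matrix (Fin n) (Fin n) ℝ}
    (hA : ∀ k, A k ∈ Matrix.colStochastic ℝ (Fin n)) {δ : ℝ} (hδ₀ : 0 < δ) {L : ℕ} (hL : 0 < L)
    (hδ : ∀ k i j, δ ≤ transition A k L i j) {x u : ℕ → Fin n → ℝ}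
    (hx : ∀ k, x (k + 1) = (A k).mulVec (x k) + u k)
    (hu : ∀ i, Tendsto (fun k => u k i / k) atTop (𝓝 0)) (i : Fin n) :
    Tendsto (fun k => (x k i - (∑ j, x k j) * pushWeight A k i) / k) atTop (𝓝 0) := by
  have hn' : (0 : ℝ) < n := by exact_mod_cast hn
  -- The deviation has sum zero and obeys the same recursion, with `v` as input, because
  -- `pushWeight` evolves by `A`.
  set e : ℕ → Fin n → ℝ := fun k => x k - (∑ j, x k j) • pushWeight A k with he
  set v : ℕ → Fin n → ℝ := fun k => u k - (∑ j, u k j) • pushWeight A (k + 1) with hv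
  have hmass : ∀ k, ∑ j, x (k + 1) j = ∑ j, x k j + ∑ j, u k j := fun k => by
    rw [hx]
    simp only [Pi.add_apply, Finset.sum_add_distrib, Matrix.sum_mulVec_of_mem_colStochastic (hA k)]
  have hrec : ∀ k, e (k + 1) = (A k).mulVec (e k) + v k := fun k => by
    simp only [he, hv]
    rw [hmass, hx, Matrix.mulVec_sub, Matrix.mulVec_smul, ← pushWeight_succ, add_smul]
    abel
  have hesum : ∀ k, ∑ i, e k i = 0 := fun k => by
    simp [he, ← Finset.mul_sum, sum_pushWeight hn hA]
  have hvle : ∀ k, ∑ i, |v k i| ≤ 2 * ∑ i, |u k i| := fun k =>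
    calc ∑ i, |v k i| ≤ ∑ i, (|u k i| + |∑ j, u k j| * pushWeight A (k + 1) i) := by
          refine Finset.sum_le_sum fun i _ => (abs_sub _ _).trans_eq ?_
          simp only [Pi.smul_apply, smul_eq_mul, abs_mul,
            abs_of_nonneg (pushWeight_nonneg hA (k + 1) i)]
      _ = ∑ i, |u k i| + |∑ j, u k j| := by
          rw [Finset.sum_add_distrib, ← Finset.mul_sum, sum_pushWeight hn hA, mul_one]
      _ ≤ 2 * ∑ i, |u k i| := by
          have := Finset.abs_sum_le_sum_abs (u k) Finset.univ
          linarith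
  set g : ℕ → ℝ := fun k => 2 * ∑ i, |u k i| with hg
  have hgdiv : Tendsto (fun k => g k / k) atTop (𝓝 0) := by
    have h := (tendsto_finsetSum Finset.univ fun i _ => (hu i).abs).const_mul 2
    simp only [abs_zero, Finset.sum_const_zero, mul_zero] at h
    refine h.congr fun k => ?_
    simp only [hg, abs_div, Nat.abs_cast]
    rw [← Finset.sum_div, mul_div_assoc]
  have hbdiv : Tendsto (fun k : ℕ => (∑ t ∈ Finset.range L, g (k + t)) / k) atTop (𝓝 0) := by
    have h := tendsto_finsetSum (Finset.range L) fun t _ => tendsto_shift_div hgdiv t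
    simp only [Finset.sum_const_zero] at h
    exact h.congr fun k => (Finset.sum_div _ _ _).symm
  have hcontr : ∀ k, ∑ i, |e (k + L) i|
      ≤ (1 - n * δ) * ∑ i, |e k i| + ∑ t ∈ Finset.range L, g (k + t) := fun k => by
    have h₁ := sum_abs_sub_transition_le hA hrec k L
    have h₂ := sum_abs_mulVec_le_of_sum_eq_zero (transition_mem_colStochastic hA k L) (hδ k)
      (hesum k)
    have h₃ : ∑ t ∈ Finset.range L, ∑ i, |v (k + t) i| ≤ ∑ t ∈ Finset.range L, g (k + t) :=
      Finset.sum_le_sum fun t _ => hvle _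
    have h₄ : ∑ i, |e (k + L) i| ≤ ∑ i, |e (k + L) i - ((transition A k L).mulVec (e k)) i|
        + ∑ i, |((transition A k L).mulVec (e k)) i| := by
      rw [← Finset.sum_add_distrib]
      refine Finset.sum_le_sum fun i _ => ?_
      simpa using abs_add_le (e (k + L) i - ((transition A k L).mulVec (e k)) i)
        (((transition A k L).mulVec (e k)) i)
    linarith
  have hnδ : n * δ ≤ 1 := by
    have h := Matrix.sum_col_of_mem_colStochastic (transition_mem_colStochastic hA 0 L) ⟨0, hn⟩
    have h' := Finset.card_nsmul_le_sum Finset.univ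
      (fun i => transition A 0 L i ⟨0, hn⟩) δ fun i _ => hδ 0 i _
    rw [h] at h'
    simpa using h'
  have hlim := tendsto_div_of_contraction
    (fun k => Finset.sum_nonneg fun i _ => abs_nonneg (e k i)) (sub_nonneg.2 hnδ)
    (by nlinarith) hL hbdiv hcontr
  refine squeeze_zero_norm (fun k => ?_) hlim
  rw [Real.norm_eq_abs, abs_div, Nat.abs_cast]
  exact div_le_div_of_nonneg_right
    (Finset.single_le_sum (f := fun i => |e k i|) (fun i _ => abs_nonneg _) (Finset.mem_univ i))
    k.cast_nonneg

/-- If the inputs have convergent averages, the state divided by `k` times the push-sum weight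
converges to the sum of these averages. -/
lemma tendsto_div_pushWeight (hn : 0 < n) {A : ℕ → Matrix (Fin n) (Fin n) ℝ}
    (hA : ∀ k, A k ∈ Matrix.colStochastic ℝ (Fin n)) {δ : ℝ} (hδ₀ : 0 < δ) {L : ℕ} (hL : 0 < L)
    (hδ : ∀ k i j, δ ≤ transition A k L i j) {x u : ℕ → Fin n → ℝ} {c : Fin n → ℝ}
    (hx : ∀ k, x (k + 1) = (A k).mulVec (x k) + u k)
    (hu : ∀ i, Tendsto (fun k : ℕ => (∑ t ∈ Finset.range k, u t i) / k) atTop (𝓝 (c i)))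
    (i : Fin n) :
    Tendsto (fun k => x k i / (k * pushWeight A k i)) atTop (𝓝 (∑ i, c i)) := by
  have hmass : ∀ k, ∑ j, x k j = ∑ j, x 0 j + ∑ j, ∑ t ∈ Finset.range k, u t j := by
    intro k
    induction k with
    | zero => simp
    | succ k ih =>
      rw [hx]
      simp only [Pi.add_apply, Finset.sum_add_distrib, Finset.sum_range_succ,
        Matrix.sum_mulVec_of_mem_colStochastic (hA k), ih]
      ring
  have hmassdiv : Tendsto (fun k : ℕ => (∑ j, x k j) / k) atTop (𝓝 (∑ i, c i)) := by
    have h := (tendsto_const_div_atTop_nhds_zero_nat (∑ j, x 0 j)).add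
      (tendsto_finsetSum Finset.univ fun i _ => hu i)
    rw [zero_add] at h
    refine h.congr fun k => ?_
    rw [hmass k, add_div, ← Finset.sum_div Finset.univ fun j => ∑ t ∈ Finset.range k, u t j]
  have hlow : ∀ᶠ k in atTop, δ ≤ pushWeight A k i := by
    filter_upwards [eventually_ge_atTop L] with k hk
    have := le_pushWeight hn hA hδ (k - L) i
    rwa [Nat.sub_add_cancel hk] at this
  have hdev := tendsto_deviation_div hn hA hδ₀ hL hδ hx
    (fun j => tendsto_div_of_tendsto_average (hu j)) i
  -- The weights may oscillate; only their lower bound `δ` is needed to divide by them.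
  have hdev' : Tendsto (fun k => (x k i - (∑ j, x k j) * pushWeight A k i) / k
      / pushWeight A k i) atTop (𝓝 0) := by
    have h := hdev.abs.div_const δ
    rw [abs_zero, zero_div] at h
    refine squeeze_zero_norm' ?_ h
    filter_upwards [hlow] with k hk
    rw [Real.norm_eq_abs, abs_div _ (pushWeight A k i), abs_of_pos (hδ₀.trans_le hk)]
    exact div_le_div_of_nonneg_left (abs_nonneg _) hδ₀ hk
  have h := hmassdiv.add hdev'
  rw [add_zero] at h
  refine h.congr' ?_
  filter_upwards [hlow, eventually_gt_atTop 0] with k hk hk₀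
  have hk₀' : (0 : ℝ) < k := by exact_mod_cast hk₀
  have hw := hδ₀.trans_le hk
  field_simp
  ring

end PushSum

/-! ### Deterministic convergence of the estimates. -/

section Estimates

variable {n : ℕ}

lemma precisionSeq_pos (G : ℕ → Digraph (Fin n)) {σ : Fin n → ℝ≥0} (hσ : ∀ i, 0 < σ i) (k : ℕ)
    (i : Fin n) : 0 < precisionSeq G σ k i := by
  induction k generalizing i with
  | zero => exact precision_pos hσ i
  | succ k ih =>
    exact add_pos_of_nonneg_of_pos (Finset.sum_nonneg fun j _ => mul_nonneg
      (Matrix.nonneg_of_mem_colStochastic (weight_mem_colStochastic _)) (ih j).le)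
      (precision_pos hσ i)

/-- Convergence of the estimates for observed values whose averages converge. -/
lemma tendsto_estimateSeq (hn : 0 < n) {G : ℕ → Digraph (Fin n)} {B : ℕ}
    (hG : BStronglyConnected G B) (θ : Fin n → ℝ) {σ : Fin n → ℝ≥0} (hσ : ∀ i, 0 < σ i)
    (θ₀ : Fin n → ℝ) {s : ℕ → Fin n → ℝ}
    (hs : ∀ i, Tendsto (fun k : ℕ => (∑ t ∈ Finset.range k, s (t + 1) i) / k) atTop (𝓝 (θ i)))
    (i : Fin n) :
    Tendsto (fun k => estimateSeq G σ θ₀ s k i) atTop (𝓝 (thetaStar θ σ)) := by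
  have hn' : (0 : ℝ) < n := by exact_mod_cast hn
  have hL : 0 < n * (2 * B) := Nat.mul_pos hn (by have := hG.1; omega)
  have hδ₀ : (0 : ℝ) < (n : ℝ)⁻¹ ^ (n * (2 * B)) := by positivity
  have hA : ∀ k, weight (G k) ∈ Matrix.colStochastic ℝ (Fin n) :=
    fun k => weight_mem_colStochastic _
  have hprec := tendsto_div_pushWeight hn hA hδ₀ hL (pow_le_transition hG)
    (x := precisionSeq G σ) (u := fun _ => precision σ) (c := precision σ) (fun k => rfl)
    (fun j => by
      refine tendsto_const_nhds.congr' ?_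
      filter_upwards [eventually_gt_atTop 0] with k hk
      have hk' : (0 : ℝ) < k := by exact_mod_cast hk
      simp [hk'.ne']) i
  -- Multiplying the estimate by its precision cancels the division in the update and makes the
  -- recursion linear.
  have hnum := tendsto_div_pushWeight hn hA hδ₀ hL (pow_le_transition hG)
    (x := fun k j => precisionSeq G σ k j * estimateSeq G σ θ₀ s k j)
    (u := fun k j => s (k + 1) j * precision σ j) (c := fun j => precision σ j * θ j)
    (fun k => by
      ext j
      simp only [estimateSeq]
      rw [mul_div_cancel₀ _ (precisionSeq_pos G hσ (k + 1) j).ne']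
      simp only [Pi.add_apply, Matrix.mulVec, dotProduct, mul_assoc])
    (fun j => by
      refine ((hs j).const_mul (precision σ j)).congr fun k => ?_
      rw [← Finset.sum_mul]
      ring) i
  refine (hnum.div hprec (sum_precision_pos hn hσ).ne').congr' ?_
  filter_upwards [eventually_ge_atTop (n * (2 * B))] with k hk
  have hw := le_pushWeight hn hA (pow_le_transition hG) (k - n * (2 * B)) i
  rw [Nat.sub_add_cancel hk] at hw
  have hw' := (hδ₀.trans_le hw).ne'
  have hk' : (k : ℝ) ≠ 0 := by exact_mod_cast (hL.trans_le hk).ne'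
  have hτ := (precisionSeq_pos G hσ k i).ne'
  rw [Pi.div_apply, div_div_div_cancel_right₀ (mul_ne_zero hk' hw'), mul_div_cancel_left₀ _ hτ]

end Estimates

/-! ### Strong law and conclusion. -/

lemma ae_tendsto_average_of_gaussian {Ω : Type*} [MeasurableSpace Ω] {P : Measure Ω}
    {X : ℕ → Ω → ℝ} {μ : ℝ} {v : ℝ≥0} (hlaw : ∀ k, HasLaw (X k) (gaussianReal μ v) P)
    (hindep : iIndepFun X P) :
    ∀ᵐ ω ∂P, Tendsto (fun k : ℕ => (∑ t ∈ Finset.range k, X t ω) / k) atTop (𝓝 μ) := by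
  have hid : Integrable (fun x : ℝ => x) (gaussianReal μ v) :=
    (memLp_id_gaussianReal (μ := μ) (v := v) 1).integrable (by simp)
  have hint : Integrable (X 0) P := by
    rw [← (hlaw 0).map_eq] at hid
    exact hid.comp_aemeasurable (hlaw 0).aemeasurable
  have hmean : ∫ ω, X 0 ω ∂P = μ := by
    rw [(hlaw 0).integral_eq, integral_id_gaussianReal]
  have h := strong_law_ae_real X hint (fun i j hij => hindep.indepFun hij)
    fun k => ⟨(hlaw k).aemeasurable, (hlaw 0).aemeasurable, by
      rw [(hlaw k).map_eq, (hlaw 0).map_eq]⟩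
  rwa [hmean] at h

end DistLearning

open DistLearning in
theorem theorem1 {n : ℕ} (hn : 0 < n)
    {Ω : Type*} [MeasurableSpace Ω] (P : Measure Ω) [IsProbabilityMeasure P]
    (G : ℕ → Digraph (Fin n)) (B : ℕ) (hG : BStronglyConnected G B)
    (θ : Fin n → ℝ) (σ : Fin n → ℝ≥0) (hσ : ∀ i, 0 < σ i)
    (S : ℕ → Fin n → Ω → ℝ)
    (hlaw : ∀ k i, HasLaw (S (k + 1) i) (gaussianReal (θ i) (σ i ^ 2)) P)
    (hindep : ∀ i, iIndepFun (fun k => S (k + 1) i) P)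
    (θ₀ : Fin n → ℝ) :
    (∀ x, x ≠ thetaStar θ σ →
      objective (fun i => gaussianReal (θ i) (σ i ^ 2)) (likelihood σ) (thetaStar θ σ) <
        objective (fun i => gaussianReal (θ i) (σ i ^ 2)) (likelihood σ) x) ∧
    ∀ i, ∀ᵐ ω ∂P,
      Tendsto (fun k => estimateSeq G σ θ₀ (fun t j => S t j ω) k i) atTop
        (𝓝 (thetaStar θ σ)) := by
  refine ⟨fun x hx => objective_thetaStar_lt hn θ σ hσ hx, fun i => ?_⟩
  -- The estimate of agent `i` involves the samples of all agents, so all averages must converge on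
  -- one almost sure event.
  filter_upwards [ae_all_iff.2 fun j =>
    ae_tendsto_average_of_gaussian (fun k => hlaw k j) (hindep j)] with ω hω
  exact tendsto_estimateSeq hn hG θ hσ θ₀ hω i
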